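/- Let $Q$ be a finite quiver (finitely many vertices and edges; loops and multiple edges are allowed) and let $\mathbb{K}$ be a field. Let $\mathbb{K}Q$ be the path algebra of $Q$: it has as a $\mathbb{K}$-basis all directed paths of $Q$, including the trivial path at each vertex, and the product $p\cdot q$ of two paths is the concatenation "first $q$, then $p$" if the target of $q$ is the source of $p$, and $0$ otherwise. Let $C\subseteq\mathbb{K}Q$ be the parallel ideal, i.e. the two-sided ideal generated by all differences $p-q$ of directed paths (trivial ones included) with the same source and the same target, and let $\mathcal{C}(Q)=\mathbb{K}Q/C$ be the commuting algebra of $Q$. Let $\mathcal{R}(Q)$ be the reachability poset of $Q$: its elements are the classes $[v]$ of vertices, where $v$ and $w$ are identified if there are (possibly trivial) paths from $v$ to $w$ and from $w$ to $v$, and $[v]\le[w]$ if there is a path from $v$ to $w$ in $Q$. Let $T(Q)$ be the underlying quiver of $\mathcal{R}(Q)$ seen as a category: its vertices are the elements of $\mathcal{R}(Q)$, with exactly one edge from $x$ to $y$ if $x\le y$ and none otherwise. Let $\mathrm{diam}(Q)$ be the maximal length (number of edges) of a directed simple path in $T(Q)$, i.e. of a directed path that visits no vertex twice; trivial paths, of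 length $0$, are allowed, and $\mathrm{diam}(Q)=0$ if $Q$ is empty. Then \[ \mathrm{gl.dim}\,\mathcal{C}(Q)\le \mathrm{diam}(Q), \] where the global dimension of a ring $R$ is the supremum of the projective dimensions of all (left) $R$-modules. -/

import Mathlib

open CategoryTheory

universe w u v k

noncomputable section

/-! ### Category algebras -/

/-- The set of all morphisms of a category. -/
abbrev AllMor (C : Type u) [Category.{v} C] : Type (max u v) := Σ (a b : C), a ⟶ b

/-- The category algebra `K C`: the free `K`-module on the set of all morphisms of `C`. -/
def CategoryAlgebra (K : Type k) [CommRing K] (C : Type u) [Category.{v} C] :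
    Type (max u v k) := AllMor C →₀ K

namespace CategoryAlgebra

variable (K : Type k) [CommRing K] {C : Type u} [Category.{v} C]

instance : AddCommGroup (CategoryAlgebra K C) := inferInstanceAs (AddCommGroup (AllMor C →₀ K))

instance : Module K (CategoryAlgebra K C) := inferInstanceAs (Module K (AllMor C →₀ K))

/-- The basis element of the category algebra given by a morphism. -/
def of (f : AllMor C) : CategoryAlgebra K C := Finsupp.single f (1 : K)

/-- The morphisms of `C` form a basis of the category algebra. -/
def basis : Module.Basis (AllMor C) K (CategoryAlgebra K C) := ⟨LinearEquiv.refl K (AllMor C →₀ K)⟩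

theorem basis_apply (f : AllMor C) : basis K f = of K f := rfl

open Classical in
/-- The product of basis elements: `f · g = f ∘ g` (first `g`, then `f`) if the target of `g` is
the source of `f`, and `f · g = 0` otherwise. -/
def mulBasis (f g : AllMor C) : CategoryAlgebra K C :=
  if h : g.2.1 = f.1 then of K ⟨g.1, f.2.1, g.2.2 ≫ eqToHom h ≫ f.2.2⟩ else 0

variable (C) in
/-- The bilinear extension of `mulBasis`. -/
def mulHom : CategoryAlgebra K C →ₗ[K] CategoryAlgebra K C →ₗ[K] CategoryAlgebra K C :=
  (basis K).constr K fun f => (basis K).constr K fun g => mulBasis K f g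

instance : Mul (CategoryAlgebra K C) := ⟨fun x y => mulHom K C x y⟩

theorem mul_def (x y : CategoryAlgebra K C) : x * y = mulHom K C x y := rfl

theorem of_mul_of (f g : AllMor C) : of K f * of K g = mulBasis K f g := by
  rw [mul_def, mulHom, ← basis_apply, ← basis_apply, Module.Basis.constr_basis,
    Module.Basis.constr_basis]

theorem of_mul_of_comp {a b c : C} (f : b ⟶ c) (g : a ⟶ b) :
    of K ⟨b, c, f⟩ * of K ⟨a, b, g⟩ = of K ⟨a, c, g ≫ f⟩ := by
  rw [of_mul_of, mulBasis, dif_pos rfl]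
  simp

theorem of_mul_of_ne (f g : AllMor C) (h : g.2.1 ≠ f.1) : of K f * of K g = 0 := by
  rw [of_mul_of, mulBasis, dif_neg h]

theorem of_assoc (f g h : AllMor C) :
    of K f * of K g * of K h = of K f * (of K g * of K h) := by
  obtain ⟨f1, f2, f⟩ := f
  obtain ⟨g1, g2, g⟩ := g
  obtain ⟨h1, h2, h⟩ := h
  by_cases e1 : g2 = f1
  · subst e1
    by_cases e2 : h2 = g1
    · subst e2
      simp only [of_mul_of_comp, Category.assoc]
    · rw [of_mul_of_comp, of_mul_of_ne K ⟨g1, g2, g⟩ ⟨h1, h2, h⟩ e2, of_mul_of_ne K _ _ e2, mul_def,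
        map_zero]
  · rw [of_mul_of_ne K ⟨f1, f2, f⟩ ⟨g1, g2, g⟩ e1]
    by_cases e2 : h2 = g1
    · subst e2
      rw [of_mul_of_comp, of_mul_of_ne K _ _ (by exact e1), mul_def, map_zero, LinearMap.zero_apply]
    · rw [of_mul_of_ne K ⟨g1, g2, g⟩ ⟨h1, h2, h⟩ e2, mul_def, mul_def, map_zero, map_zero,
        LinearMap.zero_apply]

theorem mul_assoc_aux (x y z : CategoryAlgebra K C) : x * y * z = x * (y * z) := by
  have A (f g : AllMor C) (z : CategoryAlgebra K C) :
      of K f * of K g * z = of K f * (of K g * z) := by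
    have H : mulHom K C (of K f * of K g) = mulHom K C (of K f) ∘ₗ mulHom K C (of K g) :=
      (basis K).ext fun h => of_assoc K f g h
    exact LinearMap.congr_fun H z
  have B (f : AllMor C) (y z : CategoryAlgebra K C) : of K f * y * z = of K f * (y * z) := by
    have H : (mulHom K C).flip z ∘ₗ mulHom K C (of K f) =
        mulHom K C (of K f) ∘ₗ (mulHom K C).flip z := (basis K).ext fun g => A f g z
    exact LinearMap.congr_fun H y
  have H : (mulHom K C).flip z ∘ₗ (mulHom K C).flip y = (mulHom K C).flip (y * z) :=
    (basis K).ext fun f => B f y z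
  exact LinearMap.congr_fun H x

section Unital

variable [Fintype C]

instance : One (CategoryAlgebra K C) := ⟨∑ c : C, of K ⟨c, c, 𝟙 c⟩⟩

theorem one_def : (1 : CategoryAlgebra K C) = ∑ c : C, of K ⟨c, c, 𝟙 c⟩ := rfl

theorem one_mul_of (f : AllMor C) : 1 * of K f = of K f := by
  obtain ⟨a, b, f⟩ := f
  rw [one_def, mul_def, map_sum, LinearMap.sum_apply, Finset.sum_eq_single b]
  · rw [← mul_def, of_mul_of_comp, Category.comp_id]
  · intro c _ hc
    rw [← mul_def, of_mul_of_ne K _ _ (Ne.symm hc)]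
  · simp

theorem of_mul_one (f : AllMor C) : of K f * 1 = of K f := by
  obtain ⟨a, b, f⟩ := f
  rw [one_def, mul_def, map_sum, Finset.sum_eq_single a]
  · rw [← mul_def, of_mul_of_comp, Category.id_comp]
  · intro c _ hc
    rw [← mul_def, of_mul_of_ne K _ _ hc]
  · simp

/-- If `C` has finitely many objects, the category algebra is a unital ring, with unit the sum of
the identity morphisms. -/
instance : Ring (CategoryAlgebra K C) where
  __ := (inferInstance : AddCommGroup (CategoryAlgebra K C))
  mul := (· * ·)
  one := 1
  left_distrib x y z := by simp only [mul_def, map_add]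
  right_distrib x y z := by simp only [mul_def, map_add, LinearMap.add_apply]
  zero_mul x := by simp only [mul_def, map_zero, LinearMap.zero_apply]
  mul_zero x := by simp only [mul_def, map_zero]
  mul_assoc := mul_assoc_aux K
  one_mul x := by
    have H : mulHom K C 1 = LinearMap.id := (basis K).ext fun f => one_mul_of K f
    rw [mul_def, H, LinearMap.id_apply]
  mul_one x := by
    have H : (mulHom K C).flip 1 = LinearMap.id := (basis K).ext fun f => of_mul_one K f
    rw [mul_def, ← LinearMap.flip_apply, H, LinearMap.id_apply]

instance : Algebra K (CategoryAlgebra K C) :=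
  Algebra.ofModule (fun r x y => by simp only [mul_def, map_smul, LinearMap.smul_apply])
    (fun r x y => by simp only [mul_def, map_smul])

end Unital

end CategoryAlgebra

/-! ### Path algebra and commuting algebra of a quiver -/

instance (V : Type u) [Fintype V] : Fintype (Paths V) := inferInstanceAs (Fintype V)

/-- The path algebra `K Q`: the category algebra of the path category of `Q`. -/
abbrev PathAlgebra (K : Type k) [CommRing K] (V : Type u) [Quiver.{v} V] : Type (max u v k) :=
  CategoryAlgebra K (Paths V)

/-- The element of the path algebra given by a path. -/
def PathAlgebra.ofPath (K : Type k) [CommRing K] {V : Type u} [Quiver.{v} V] {a b : V}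
    (p : Quiver.Path a b) : PathAlgebra K V :=
  CategoryAlgebra.of K (C := Paths V) ⟨a, b, p⟩

/-- The parallel ideal: the two-sided ideal of the path algebra generated by all differences of
paths with the same source and the same target. -/
def parallelIdeal (K : Type k) [CommRing K] (V : Type u) [Quiver.{v} V] [Fintype V] :
    TwoSidedIdeal (PathAlgebra K V) :=
  TwoSidedIdeal.span {x | ∃ (a b : V) (p q : Quiver.Path a b),
    x = PathAlgebra.ofPath K p - PathAlgebra.ofPath K q}

/-- The commuting algebra `C(Q)`: the path algebra modulo the parallel ideal. -/
abbrev CommutingAlgebra (K : Type k) [CommRing K] (V : Type u) [Quiver.{v} V] [Fintype V] :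
    Type (max u v k) :=
  (parallelIdeal K V).ringCon.Quotient

/-! ### The reachability poset and the quiver `T(Q)` -/

/-- The vertices of a quiver, regarded as the objects of the reachability category. -/
def Reach (V : Type u) : Type u := V

/-- `v ≤ w` if there is a (possibly trivial) path from `v` to `w`. The thin category attached to
this preorder is the reachability category. -/
instance (V : Type u) [Quiver.{v} V] : Preorder (Reach V) where
  le a b := Nonempty (@Quiver.Path V _ a b)
  le_refl _ := ⟨Quiver.Path.nil⟩
  le_trans _ _ _ := fun ⟨p⟩ ⟨q⟩ => ⟨p.comp q⟩

/-- The reachability poset: vertices modulo mutual reachability, ordered by reachability. -/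
abbrev ReachPoset (V : Type u) [Quiver.{v} V] : Type u :=
  Antisymmetrization (Reach V) (· ≤ ·)

/-- The vertices of the quiver `T(Q)`, i.e. the elements of the reachability poset. -/
def TQuiver (V : Type u) [Quiver.{v} V] : Type u := ReachPoset V

/-- `T(Q)` is the underlying quiver of the reachability poset seen as a category: it has exactly one
edge from `x` to `y` if `x ≤ y` and none otherwise (in particular, one loop at each vertex). -/
instance (V : Type u) [Quiver.{v} V] : Quiver.{u} (TQuiver V) :=
  inferInstanceAs (Quiver.{u} (ReachPoset V))

/-- A path is simple if it does not visit a vertex twice. -/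
def Quiver.Path.IsSimplePath {V : Type u} [Quiver.{v} V] {a b : V} (p : Quiver.Path a b) : Prop :=
  p.vertices.Nodup

/-- The set of lengths of the directed simple paths in `T(Q)`. -/
def simplePathLengths (V : Type u) [Quiver.{v} V] : Set ℕ :=
  {n | ∃ (a b : TQuiver V) (p : Quiver.Path a b), p.IsSimplePath ∧ p.length = n}

/-- The maximal length of a directed simple path in `T(Q)` (and `0` if `Q` is empty). -/
def diam (V : Type u) [Quiver.{v} V] : ℕ := sSup (simplePathLengths V)

theorem bddAbove_simplePathLengths (V : Type u) [Quiver.{v} V] [Finite V] :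
    BddAbove (simplePathLengths V) := by
  have : Finite (Reach V) := ‹Finite V›
  have : Finite (TQuiver V) := Finite.of_surjective (toAntisymmetrization (α := Reach V) (· ≤ ·))
    Quotient.mk_surjective
  have := Fintype.ofFinite (TQuiver V)
  refine ⟨Fintype.card (TQuiver V), ?_⟩
  rintro n ⟨a, b, p, hp, rfl⟩
  have h := List.Nodup.length_le_card hp
  rw [Quiver.Path.vertices_length] at h
  omega

/-- On a non-empty finite quiver the maximum in the definition of `diam` is attained. -/
theorem diam_mem (V : Type u) [Quiver.{v} V] [Finite V] [Nonempty V] :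
    diam V ∈ simplePathLengths V := by
  refine Nat.sSup_mem ?_ (bddAbove_simplePathLengths V)
  obtain ⟨x⟩ := ‹Nonempty V›
  let y : TQuiver V := toAntisymmetrization (α := Reach V) (· ≤ ·) x
  exact ⟨0, y, y, Quiver.Path.nil, by simp [Quiver.Path.IsSimplePath], rfl⟩

/-! ### Global dimension -/

/-- The (left) global dimension of a ring: the supremum of the projective dimensions of all its
left modules (in an arbitrary universe that contains the ring). The zero module has projective
dimension `⊥`, so the zero ring has global dimension `⊥`. -/
def globalDimension (R : Type u) [Ring R] : WithBot ℕ∞ :=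
  ⨆ M : ModuleCat.{max u w} R, projectiveDimension M

end

open scoped TensorProduct

/-! ### Rings with a system of matrix-like units indexed by a preorder -/

/-! Write `A` for the commuting algebra and `e_x` for the class of the trivial path at `x`. Parallel
paths agree in `A`, so `e_y A e_x` is spanned by one element `ε y x` if `x ≤ y` and is zero
otherwise. Only this, `∑ e_x = 1` and the composition rule are needed: no linear independence, and
no passage from the preorder to its poset. For a module `M`, the module `A e_x ⊗[K] e_x M` is
projective and maps to `M` (`cover`). The cokernel vanishes at `x`. The kernel lives strictly above
`x`: at `y` equivalent to `x` the map is injective because `ε x y` undoes `ε y x`, and at `y` not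
above `x` the source is zero. Hence a double induction, on a height bound (for kernels) and on the
support (for cokernels), bounds the projective dimension of `M`; this is
`hasProjectiveDimensionLT_of_support`. The height of `x` is the maximal length of a simple path in
`T(Q)` starting at its class, so it is at most `diam`. -/

/-- Elements `ε y x` of a `K`-algebra `A`, indexed by pairs of elements of a finite preorder, that
behave like the images of the intervals `x ≤ y` in a quotient of the incidence algebra. -/
structure IntervalUnits (K : Type k) [Field K] (A : Type u) [Ring A] [Algebra K A]
    (X : Type v) [Fintype X] [Preorder X] where
  /-- The unit attached to a pair of elements. -/
  ε : X → X → A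
  sum_eq_one : ∑ x, ε x x = 1
  mul_eq : ∀ x y z : X, x ≤ y → y ≤ z → ε z y * ε y x = ε z x
  corner : ∀ (a : A) (x y : X), x ≤ y → ∃ c : K, ε y y * a * ε x x = c • ε y x
  corner_eq_zero : ∀ (a : A) (x y : X), ¬ x ≤ y → ε y y * a * ε x x = 0

namespace IntervalUnits

variable {K : Type k} [Field K] {A : Type u} [Ring A] [Algebra K A]
  {X : Type v} [Fintype X] [Preorder X] (E : IntervalUnits K A X)

theorem mul_self (x : X) : E.ε x x * E.ε x x = E.ε x x := E.mul_eq x x x le_rfl le_rfl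

theorem eq_zero_of_forall_smul_eq_zero {M : Type*} [AddCommGroup M] [Module A M] {m : M}
    (h : ∀ y, E.ε y y • m = 0) : m = 0 := by
  rw [← one_smul A m, ← E.sum_eq_one, Finset.sum_smul]
  exact Finset.sum_eq_zero fun y _ => h y

/-- The projective left ideal generated by a diagonal unit. -/
abbrev leftIdeal (x : X) : Submodule A A := Submodule.span A {E.ε x x}

theorem mul_right_of_mem_leftIdeal {x : X} {a : A} (ha : a ∈ E.leftIdeal x) : a * E.ε x x = a := by
  obtain ⟨b, rfl⟩ := Submodule.mem_span_singleton.mp ha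
  rw [smul_eq_mul, mul_assoc, E.mul_self]

theorem mem_leftIdeal {x y : X} (h : x ≤ y) : E.ε y x ∈ E.leftIdeal x :=
  Submodule.mem_span_singleton.mpr ⟨E.ε y x, E.mul_eq x x y le_rfl h⟩

/-- Right multiplication by the idempotent `ε x x` retracts `A` onto the left ideal. -/
instance (x : X) : Module.Projective A (E.leftIdeal x) := by
  refine Module.Projective.of_split (E.leftIdeal x).subtype
    ((LinearMap.toSpanSingleton A A (E.ε x x)).codRestrict (E.leftIdeal x)
      fun a => Submodule.mem_span_singleton.mpr ⟨a, rfl⟩) ?_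
  ext a
  exact E.mul_right_of_mem_leftIdeal a.2

/-! ### The canonical map `A e_x ⊗ e_x M → M`: kernel and cokernel. -/

section Cover

variable (M : Type w) [AddCommGroup M] [Module A M] [Module K M] [IsScalarTower K A M]

/-- The part of a module at `x`. -/
def component (x : X) : Submodule K M := LinearMap.range (Algebra.lsmul K K M (E.ε x x))

variable {M}

theorem smul_mem_component (x : X) (m : M) : E.ε x x • m ∈ E.component M x := ⟨m, rfl⟩

theorem smul_of_mem_component {x : X} {m : M} (hm : m ∈ E.component M x) : E.ε x x • m = m := by
  obtain ⟨m, rfl⟩ := hm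
  simp only [Algebra.lsmul_coe, smul_smul, E.mul_self]

variable (M)

/-- The canonical map from the projective module generated by the part of `M` at `x`. -/
def cover (x : X) : E.leftIdeal x ⊗[K] E.component M x →ₗ[A] M :=
  TensorProduct.AlgebraTensorModule.lift
    { toFun a := (Algebra.lsmul K K M (a : A)).comp (E.component M x).subtype
      map_add' a b := by ext; simp
      map_smul' a b := by ext; simp }

variable {M}

theorem cover_tmul (x : X) (a : E.leftIdeal x) (m : E.component M x) :
    E.cover M x (a ⊗ₜ m) = (a : A) • (m : M) := rfl

/-- This is what removes `x` from the support of the cokernel. -/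
theorem smul_mem_range_cover (x : X) (m : M) : E.ε x x • m ∈ LinearMap.range (E.cover M x) := by
  refine ⟨⟨E.ε x x, E.mem_leftIdeal le_rfl⟩ ⊗ₜ ⟨E.ε x x • m, E.smul_mem_component x m⟩, ?_⟩
  rw [cover_tmul, smul_smul, E.mul_self]

/-- On a pure tensor `a ⊗ m`, `ε y y * a` is a scalar multiple of `ε y x`, and the scalar moves
across the tensor sign. -/
theorem exists_smul_eq_tmul {x y : X} (h : x ≤ y) (t : E.leftIdeal x ⊗[K] E.component M x) :
    ∃ m : E.component M x, E.ε y y • t = ⟨E.ε y x, E.mem_leftIdeal h⟩ ⊗ₜ m := by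
  induction t with
  | zero => exact ⟨0, by simp⟩
  | add s t hs ht =>
    obtain ⟨m, hm⟩ := hs
    obtain ⟨n, hn⟩ := ht
    exact ⟨m + n, by rw [smul_add, hm, hn, TensorProduct.tmul_add]⟩
  | tmul a m =>
    obtain ⟨c, hc⟩ := E.corner a x y h
    refine ⟨c • m, ?_⟩
    rw [← TensorProduct.smul_tmul, TensorProduct.smul_tmul']
    congr 1
    ext
    rw [mul_assoc, E.mul_right_of_mem_leftIdeal a.2] at hc
    exact hc

theorem smul_eq_zero_of_not_le {x y : X} (h : ¬ x ≤ y) (t : E.leftIdeal x ⊗[K] E.component M x) :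
    E.ε y y • t = 0 := by
  induction t with
  | zero => simp
  | add s t hs ht => rw [smul_add, hs, ht, add_zero]
  | tmul a m =>
    have hc := E.corner_eq_zero a x y h
    rw [mul_assoc, E.mul_right_of_mem_leftIdeal a.2] at hc
    have : E.ε y y • a = 0 := Subtype.ext hc
    rw [TensorProduct.smul_tmul', this, TensorProduct.zero_tmul]

theorem smul_eq_zero_of_mem_ker_cover {x y : X} (h : ¬ x < y)
    {t : E.leftIdeal x ⊗[K] E.component M x} (ht : E.cover M x t = 0) : E.ε y y • t = 0 := by
  by_cases hxy : x ≤ y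
  · have hyx : y ≤ x := not_lt_iff_le_imp_ge.mp h hxy
    obtain ⟨m, hm⟩ := E.exists_smul_eq_tmul hxy t
    have h0 : E.ε y x • (m : M) = 0 := by
      have := congrArg (E.cover M x) hm
      rwa [map_smul, ht, smul_zero, cover_tmul, eq_comm] at this
    -- Since `y ≤ x` as well, `ε x y` is a left inverse of `ε y x` on the part of `M` at `x`.
    have h1 : m = 0 := by
      apply Subtype.ext
      change (m : M) = 0
      rw [← E.smul_of_mem_component m.2, ← E.mul_eq x y x hxy hyx, mul_smul, h0, smul_zero]
    rw [hm, h1, TensorProduct.tmul_zero]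
  · exact E.smul_eq_zero_of_not_le hxy t

end Cover

/-- Two short exact sequences meet at the image of `f`: kernel, `P`, image, and image, `M`,
cokernel. The first costs one dimension, the second none. -/
theorem _root_.ModuleCat.hasProjectiveDimensionLT_of_ker_of_coker {R : Type u} [Ring R]
    {P M : Type max u w} [AddCommGroup P] [Module R P] [Module.Projective R P]
    [AddCommGroup M] [Module R M] (f : P →ₗ[R] M) (n : ℕ)
    (hk : HasProjectiveDimensionLT (ModuleCat.of R (LinearMap.ker f)) n)
    (hc : HasProjectiveDimensionLT (ModuleCat.of R (M ⧸ LinearMap.range f)) (n + 1)) :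
    HasProjectiveDimensionLT (ModuleCat.of R M) (n + 1) := by
  let S : ShortComplex (ModuleCat.{max u w} R) :=
    ShortComplex.mk (ModuleCat.ofHom (LinearMap.ker f).subtype) (ModuleCat.ofHom f.rangeRestrict)
      (by ext x; exact x.2)
  have hS : S.ShortExact := by
    refine ModuleCat.shortComplex_shortExact S ?_ ?_ ?_
    · intro y
      exact ⟨fun h => ⟨⟨y, congrArg Subtype.val h⟩, rfl⟩, by rintro ⟨x, rfl⟩; exact Subtype.ext x.2⟩
    · exact Subtype.val_injective
    · exact f.surjective_rangeRestrict
  let T : ShortComplex (ModuleCat.{max u w} R) :=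
    ShortComplex.mk (ModuleCat.ofHom (LinearMap.range f).subtype)
      (ModuleCat.ofHom (LinearMap.range f).mkQ)
      (by ext x; exact (Submodule.Quotient.mk_eq_zero _).mpr x.2)
  have hT : T.ShortExact := by
    refine ModuleCat.shortComplex_shortExact T ?_ ?_ ?_
    · intro y
      refine (Submodule.Quotient.mk_eq_zero _).trans ?_
      exact ⟨fun h => ⟨⟨y, h⟩, rfl⟩, by rintro ⟨x, rfl⟩; exact x.2⟩
    · exact Subtype.val_injective
    · exact Submodule.mkQ_surjective _
  have : Projective (ModuleCat.of R P) := (IsProjective.iff_projective P).mp inferInstance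
  have hP : HasProjectiveDimensionLT S.X₂ (n + 1) :=
    hasProjectiveDimensionLT_of_ge (ModuleCat.of R P) 1 (n + 1) (by omega)
  have hI : HasProjectiveDimensionLT T.X₁ (n + 1) := hS.hasProjectiveDimensionLT_X₃ n hk hP
  exact hT.hasProjectiveDimensionLT_X₂ (n + 1) hI hc

theorem _root_.ModuleCat.hasProjectiveDimensionLT_of_subsingleton {R : Type u} [Ring R]
    (M : ModuleCat.{w} R) [Small.{w} R] [Subsingleton M] (n : ℕ) : HasProjectiveDimensionLT M n :=
  have := (ModuleCat.isZero_of_subsingleton M).hasProjectiveDimensionLT_zero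
  hasProjectiveDimensionLT_of_ge M 0 n (Nat.zero_le n)

/-- A module supported on a set of elements of height less than `n` has projective dimension
less than `n`, where the height is any function that strictly decreases along the preorder. -/
theorem hasProjectiveDimensionLT_of_support (height : X → ℕ)
    (hheight : ∀ x y, x < y → height y < height x) (n : ℕ) :
    ∀ (S : Finset X) (M : Type max u w) [AddCommGroup M] [Module A M], (∀ s ∈ S, height s < n) →
      (∀ y ∉ S, ∀ m : M, E.ε y y • m = 0) →
      HasProjectiveDimensionLT (ModuleCat.of A M) n := by
  classical
  induction n with
  | zero =>
    intro S M _ _ hS hM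
    have : Subsingleton M := subsingleton_of_forall_eq 0 fun m =>
      E.eq_zero_of_forall_smul_eq_zero fun y => hM y (fun hy => absurd (hS y hy) (by omega)) m
    exact ModuleCat.hasProjectiveDimensionLT_of_subsingleton.{max u w} _ _
  | succ n ih =>
    intro S
    induction S using Finset.induction_on with
    | empty =>
      intro M _ _ _ hM
      have : Subsingleton M := subsingleton_of_forall_eq 0 fun m =>
        E.eq_zero_of_forall_smul_eq_zero fun y => hM y (by simp) m
      exact ModuleCat.hasProjectiveDimensionLT_of_subsingleton.{max u w} _ _
    | insert x S hx ihS =>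
      intro M _ _ hS hM
      let _ : Module K M := Module.compHom M (algebraMap K A)
      have : IsScalarTower K A M := ⟨fun c a m => by
        rw [Algebra.smul_def, mul_smul]; rfl⟩
      refine ModuleCat.hasProjectiveDimensionLT_of_ker_of_coker.{w} (E.cover M x) n ?_ ?_
      -- The kernel is supported strictly above `x`, where heights are smaller: the bound `n`
      -- applies, whatever the size of the support.
      · refine ih {y | x < y} _ ?_ ?_
        · intro y hy
          have h1 := hheight x y (by simpa using hy)
          have h2 := hS x (by simp)
          omega
        · intro y hy t
          exact Subtype.ext (E.smul_eq_zero_of_mem_ker_cover (by simpa using hy) t.2)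
      -- The cokernel keeps the bound `n + 1` but loses `x` from its support.
      · refine ihS _ (fun s hs => hS s (by simp [hs])) ?_
        intro y hy q
        obtain ⟨m, rfl⟩ := Submodule.mkQ_surjective _ q
        rw [← map_smul, Submodule.mkQ_apply, Submodule.Quotient.mk_eq_zero]
        by_cases hyx : y = x
        · subst hyx
          exact E.smul_mem_range_cover y m
        · rw [hM y (by simp [hyx, hy])]
          exact Submodule.zero_mem _

theorem globalDimension_le (F : IntervalUnits K A X) (height : X → ℕ) (hheight : ∀ x y, x < y → height y < height x)
    {d : ℕ} (hd : ∀ x, height x ≤ d) : globalDimension.{w} A ≤ d := by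
  refine iSup_le fun M => (projectiveDimension_le_iff M d).mpr ?_
  exact F.hasProjectiveDimensionLT_of_support.{w} height hheight (d + 1) Finset.univ M
    (fun s _ => Nat.lt_succ_of_le (hd s)) (by simp)

end IntervalUnits

/-! ### Simple paths in the reachability poset -/

section Height

variable {V : Type u} [Quiver.{v} V]

theorem TQuiver.le_of_mem_vertices {a b : TQuiver V} (p : Quiver.Path a b) :
    ∀ c ∈ p.vertices, (show ReachPoset V from a) ≤ c := by
  induction p with
  | nil =>
    intro c hc
    exact (show c = a by simpa using hc) ▸ le_refl (α := ReachPoset V) a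
  | cons p e ih =>
    intro c hc
    rcases (Quiver.Path.mem_vertices_cons p e).mp hc with hc | rfl
    · exact ih c hc
    · exact (ih _ p.end_mem_vertices).trans (leOfHom e)

/-- The lengths of the simple paths in `T(Q)` starting at a given vertex. -/
def simplePathLengthsFrom (a : TQuiver V) : Set ℕ :=
  {n | ∃ (b : TQuiver V) (p : Quiver.Path a b), p.IsSimplePath ∧ p.length = n}

/-- The maximal length of a simple path in `T(Q)` starting at a given vertex. -/
noncomputable def simplePathHeight (a : TQuiver V) : ℕ := sSup (simplePathLengthsFrom a)

theorem simplePathLengthsFrom_subset (a : TQuiver V) :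
    simplePathLengthsFrom a ⊆ simplePathLengths V := fun _ ⟨b, p, h⟩ => ⟨a, b, p, h⟩

theorem zero_mem_simplePathLengthsFrom (a : TQuiver V) : 0 ∈ simplePathLengthsFrom a :=
  ⟨a, Quiver.Path.nil, by simp [Quiver.Path.IsSimplePath], rfl⟩

theorem simplePathHeight_le_diam [Finite V] (a : TQuiver V) : simplePathHeight a ≤ diam V :=
  csSup_le_csSup (bddAbove_simplePathLengths V) ⟨0, zero_mem_simplePathLengthsFrom a⟩
    (simplePathLengthsFrom_subset a)

/-- Prepending the edge from `a` to `b` to a longest simple path from `b` keeps it simple: all its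
vertices are at least `b`, hence different from `a`. -/
theorem simplePathHeight_lt [Finite V] {a b : TQuiver V} (h : (show ReachPoset V from a) < b) :
    simplePathHeight b < simplePathHeight a := by
  have bdd (c : TQuiver V) : BddAbove (simplePathLengthsFrom c) :=
    (bddAbove_simplePathLengths V).mono (simplePathLengthsFrom_subset c)
  obtain ⟨c, p, hp, hl⟩ := Nat.sSup_mem ⟨0, zero_mem_simplePathLengthsFrom b⟩ (bdd b)
  let e : a ⟶ b := homOfLE (X := ReachPoset V) h.le
  refine Nat.lt_of_succ_le (le_csSup (bdd a) ⟨c, e.toPath.comp p, ?_, ?_⟩)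
  · rw [Quiver.Path.IsSimplePath, Quiver.Path.vertices_comp, Quiver.Path.vertices_toPath]
    refine List.nodup_cons.mpr ⟨fun ha => ?_, hp⟩
    exact absurd (TQuiver.le_of_mem_vertices p a ha) (not_le_of_gt h)
  · rw [Quiver.Path.length_comp, hl, Quiver.Path.length_toPath, Nat.add_comm]
    rfl

end Height

/-! ### The commuting algebra -/

namespace CommutingAlgebra

variable (K : Type k) [Field K] {V : Type u} [Quiver.{v} V] [Fintype V]

instance : Fintype (Reach V) := inferInstanceAs (Fintype V)

/-- The class of a path in the commuting algebra. -/
noncomputable def ofPath {a b : V} (p : Quiver.Path a b) : CommutingAlgebra K V :=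
  (parallelIdeal K V).ringCon.mk' (PathAlgebra.ofPath K p)

theorem ofPath_eq {a b : V} (p q : Quiver.Path a b) : ofPath K p = ofPath K q := by
  refine (RingCon.eq _).mpr ((TwoSidedIdeal.rel_iff _ _ _).mpr ?_)
  exact TwoSidedIdeal.subset_span ⟨a, b, p, q, rfl⟩

theorem ofPath_mul_ofPath {a b c : V} (q : Quiver.Path b c) (p : Quiver.Path a b) :
    ofPath K q * ofPath K p = ofPath K (p.comp q) := by
  refine (map_mul (parallelIdeal K V).ringCon.mk' _ _).symm.trans ?_
  exact congrArg _ (CategoryAlgebra.of_mul_of_comp K (C := Paths V) q p)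

theorem ofPath_mul_ofPath_of_ne {a b c d : V} (q : Quiver.Path c d) (p : Quiver.Path a b)
    (h : b ≠ c) : ofPath K q * ofPath K p = 0 := by
  refine (map_mul (parallelIdeal K V).ringCon.mk' _ _).symm.trans ?_
  refine (congrArg _ (CategoryAlgebra.of_mul_of_ne K (C := Paths V) _ _ h)).trans (map_zero _)

theorem sum_ofPath_nil :
    ∑ x : V, ofPath K (Quiver.Path.nil : Quiver.Path x x) = 1 :=
  (map_sum (parallelIdeal K V).ringCon.mk' _ _).symm.trans (map_one _)

theorem induction_on {p : CommutingAlgebra K V → Prop} (a : CommutingAlgebra K V) (zero : p 0)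
    (add : ∀ a b, p a → p b → p (a + b)) (smul : ∀ (c : K) a, p a → p (c • a))
    (ofPath : ∀ (x y : V) (q : Quiver.Path x y), p (ofPath K q)) : p a := by
  obtain ⟨a, rfl⟩ := RingCon.mk'_surjective _ a
  induction (CategoryAlgebra.basis K (C := Paths V)).mem_span a using Submodule.span_induction with
  | mem x h =>
    obtain ⟨⟨x, y, q⟩, rfl⟩ := h
    exact ofPath x y q
  | zero => rwa [map_zero]
  | add x y _ _ hx hy => rw [map_add]; exact add _ _ hx hy
  | smul c x _ hx => exact smul c _ hx

theorem corner_ofPath_eq_zero {a b x y : V} (q : Quiver.Path a b) (h : a ≠ x ∨ b ≠ y) :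
    ofPath K (Quiver.Path.nil : Quiver.Path y y) * ofPath K q *
      ofPath K (Quiver.Path.nil : Quiver.Path x x) = 0 := by
  rcases h with h | h
  · rw [mul_assoc, ofPath_mul_ofPath_of_ne K q _ h.symm, mul_zero]
  · rw [ofPath_mul_ofPath_of_ne K _ q h, zero_mul]

/-- By linearity it suffices to take the class of a path: the corner kills it unless it is parallel
to `p`, and then it equals the class of `p`. -/
theorem exists_corner_eq_smul {x y : V} (p : Quiver.Path x y) (a : CommutingAlgebra K V) :
    ∃ c : K, ofPath K (Quiver.Path.nil : Quiver.Path y y) * a *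
      ofPath K (Quiver.Path.nil : Quiver.Path x x) = c • ofPath K p := by
  induction a using induction_on with
  | zero => exact ⟨0, by simp⟩
  | add a b ha hb =>
    obtain ⟨c, hc⟩ := ha
    obtain ⟨d, hd⟩ := hb
    exact ⟨c + d, by rw [mul_add, add_mul, hc, hd, add_smul]⟩
  | smul d a ha =>
    obtain ⟨c, hc⟩ := ha
    exact ⟨d * c, by rw [mul_smul_comm, smul_mul_assoc, hc, mul_smul]⟩
  | ofPath s t q =>
    by_cases h : s = x ∧ t = y
    · obtain ⟨rfl, rfl⟩ := h
      exact ⟨1, by rw [ofPath_mul_ofPath, ofPath_mul_ofPath, one_smul]; exact ofPath_eq K _ _⟩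
    · exact ⟨0, by rw [zero_smul, corner_ofPath_eq_zero K q (by tauto)]⟩

theorem corner_eq_zero {x y : V} (h : IsEmpty (Quiver.Path x y)) (a : CommutingAlgebra K V) :
    ofPath K (Quiver.Path.nil : Quiver.Path y y) * a *
      ofPath K (Quiver.Path.nil : Quiver.Path x x) = 0 := by
  induction a using induction_on with
  | zero => simp
  | add a b ha hb => rw [mul_add, add_mul, ha, hb, add_zero]
  | smul d a ha => rw [mul_smul_comm, smul_mul_assoc, ha, smul_zero]
  | ofPath s t q =>
    refine corner_ofPath_eq_zero K q ?_
    by_contra! hst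
    obtain ⟨rfl, rfl⟩ := hst
    exact h.false q

variable (V) in
open Classical in
/-- The classes of paths, as units indexed by the reachability preorder. -/
noncomputable def intervalUnits : IntervalUnits K (CommutingAlgebra K V) (Reach V) :=
  -- The chosen path is immaterial by `ofPath_eq`; the value `0` is a default that no field of the
  -- structure refers to.
  let ε (y x : Reach V) : CommutingAlgebra K V := if h : x ≤ y then ofPath K h.some else 0
  have hε (x y : V) (p : Quiver.Path x y) : ε y x = ofPath K p :=
    (dif_pos (⟨p⟩ : @LE.le (Reach V) _ x y)).trans (ofPath_eq K _ _)
  have hnil (x : V) : ε x x = ofPath K (Quiver.Path.nil : Quiver.Path x x) := hε x x _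
  { ε := ε
    sum_eq_one := (Finset.sum_congr rfl fun x _ => hnil x).trans (sum_ofPath_nil K)
    mul_eq := fun x y z ⟨p⟩ ⟨q⟩ => by
      rw [hε x y p, hε y z q, hε x z (Quiver.Path.comp p q)]
      exact ofPath_mul_ofPath K (V := V) q p
    corner := fun a x y ⟨p⟩ => by
      rw [hε x y p, hnil x, hnil y]
      exact exists_corner_eq_smul K p a
    corner_eq_zero := fun a x y h => by
      rw [hnil x, hnil y]
      exact corner_eq_zero K (not_nonempty_iff.mp h) a }

end CommutingAlgebra

theorem mainTheorem6 (K : Type k) [Field K] (V : Type u) [Quiver.{v} V] [Fintype V]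
    [∀ a b : V, Finite (a ⟶ b)] :
    globalDimension.{w} (CommutingAlgebra K V) ≤ (diam V : WithBot ℕ∞) :=
  (CommutingAlgebra.intervalUnits K V).globalDimension_le
    (fun x => simplePathHeight (V := V) (toAntisymmetrization (α := Reach V) (· ≤ ·) x))
    (fun _ _ h => simplePathHeight_lt (toAntisymmetrization_lt_toAntisymmetrization_iff.mpr h))
    fun _ => simplePathHeight_le_diam _
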